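/- Let $d\geq 3$ be an integer and let $t$ be a real number. For a vector $a=(a_1,\dots,a_d)$ in the open orthant $]0,+\infty[^d$, put $b(a)=\frac12\sum_{i=1}^d a_i-t$ and let $H_a=\{x\in\mathbb{R}^d : a\cdot x=b(a)\}$. Then the $(d-1)$-dimensional volume of $H_a\cap[0,1]^d$ is finite for every $a\in\,]0,+\infty[^d$ and, as a function of $a$ (with $t$ fixed), it is continuously differentiable on $]0,+\infty[^d$. -/

import Mathlib

open MeasureTheory

/-- The cube `[0,1]^d` in Euclidean space of dimension `d`. -/
def unitCube (d : ℕ) : Set (EuclideanSpace ℝ (Fin d)) :=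
  {x | ∀ i, x i ∈ Set.Icc (0 : ℝ) 1}

/-- The open orthant `]0,∞[^d`. -/
def openOrthant (d : ℕ) : Set (EuclideanSpace ℝ (Fin d)) :=
  {a | ∀ i, 0 < a i}

/-- The number `b = σ(a)/2 - t`, where `σ(a)` is the sum of the coordinates of `a`. -/
noncomputable def offset {d : ℕ} (t : ℝ) (a : EuclideanSpace ℝ (Fin d)) : ℝ :=
  (∑ i, a i) / 2 - t

/-- The hyperplane `H` of the points `x` such that `a · x = b`, with `b = σ(a)/2 - t`. -/
def sectionHyperplane {d : ℕ} (t : ℝ) (a : EuclideanSpace ℝ (Fin d)) :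
    Set (EuclideanSpace ℝ (Fin d)) :=
  {x | inner ℝ a x = offset t a}

/-- The `(d-1)`-dimensional volume of `H ∩ [0,1]^d`, as an extended nonnegative real number:
its `(d-1)`-dimensional Hausdorff measure for the Euclidean distance, in the normalization that
agrees with Lebesgue measure on `(d-1)`-dimensional Euclidean space. -/
noncomputable def sectionVolume {d : ℕ} (t : ℝ) (a : EuclideanSpace ℝ (Fin d)) : ENNReal :=
  Measure.euclideanHausdorffMeasure (d - 1) (sectionHyperplane t a ∩ unitCube d)

/-! Put n = d - 1. Solving `a · x = b` for `x 0` shows the section as a graph over a slab section of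
`[0,1]^n`, so its volume is the slab volume times a Jacobian (`sectionVolume_eq`). The slab volume
is the integral over `[0,1]^n` of the indicator of `[0, a 0]` evaluated at `b - ∑ aᵢ yᵢ`.
Integrating out one coordinate replaces the function by an antiderivative, takes a difference of
step `aᵢ` and divides by `aᵢ`. This yields a closed formula in the n-th antiderivative
(`volume_real_cube_inter_slab`), built from truncated n-th powers. These are C¹ once n ≥ 2, and the
other factors are smooth on the orthant. -/

/-- Iterated backward difference of `h` with steps `a 0, …, a (n - 1)`. -/
noncomputable def iteratedDiff : (n : ℕ) → (Fin n → ℝ) → (ℝ → ℝ) → ℝ → ℝ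
  | 0, _, h => h
  | n + 1, a, h => fun b =>
      iteratedDiff n (Fin.tail a) h b - iteratedDiff n (Fin.tail a) h (b - a 0)

/-- `H` varies with the parameter because the indicator of `[0, a 0]` itself depends on `a`. -/
theorem ContDiff.iteratedDiff {V : Type*} [NormedAddCommGroup V] [NormedSpace ℝ V]
    {m : WithTop ℕ∞} {H : V → ℝ → ℝ} (hH : ContDiff ℝ m fun p : V × ℝ => H p.1 p.2) :
    ∀ (n : ℕ) {a : V → Fin n → ℝ} {b : V → ℝ}, (∀ i, ContDiff ℝ m fun v => a v i) →
      ContDiff ℝ m b → ContDiff ℝ m fun v => _root_.iteratedDiff n (a v) (H v) (b v)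
  | 0, _, _, _, hb => hH.comp (contDiff_id.prodMk hb)
  | n + 1, _, _, ha, hb =>
    (ContDiff.iteratedDiff hH n (fun i => ha i.succ) hb).sub
      (ContDiff.iteratedDiff hH n (fun i => ha i.succ) (hb.sub (ha 0)))

/-! ### Ridge functions on the cube -/

/-- Lebesgue measure on the cube `[0,1]^n`. -/
noncomputable def cubeMeasure (n : ℕ) : Measure (Fin n → ℝ) :=
  Measure.pi fun _ => volume.restrict (Set.Icc (0 : ℝ) 1)

instance (n : ℕ) : IsFiniteMeasure (cubeMeasure n) := by
  unfold cubeMeasure; infer_instance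

theorem cubeMeasure_eq_restrict (n : ℕ) :
    cubeMeasure n = volume.restrict {y : Fin n → ℝ | ∀ i, y i ∈ Set.Icc (0 : ℝ) 1} := by
  rw [cubeMeasure, ← Measure.restrict_pi_pi, volume_pi]
  congr 1
  ext y
  simp only [Set.mem_pi, Set.mem_univ, true_imp_iff]
  rfl

theorem measurableSet_cube (n : ℕ) :
    MeasurableSet {y : Fin n → ℝ | ∀ i, y i ∈ Set.Icc (0 : ℝ) 1} := by
  simp only [Set.ofPred_forall]
  exact MeasurableSet.iInter fun i => measurableSet_Icc.preimage (measurable_pi_apply i)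

/-- Local boundedness replaces continuity so that indicators are covered. -/
theorem integrable_comp_sub_sum {n : ℕ} {h : ℝ → ℝ} (hm : Measurable h)
    (hb : ∀ M : ℝ, ∃ C, ∀ x, |x| ≤ M → |h x| ≤ C) (a : Fin n → ℝ) (b : ℝ) :
    Integrable (fun y => h (b - ∑ i, a i * y i)) (cubeMeasure n) := by
  obtain ⟨C, hC⟩ := hb (|b| + ∑ i, |a i|)
  refine Integrable.of_bound (C := C) ?_ ?_
  · exact (hm.comp (by fun_prop)).aestronglyMeasurable
  · rw [cubeMeasure_eq_restrict]
    refine (ae_restrict_iff' (measurableSet_cube n)).2 (ae_of_all _ fun y hy => hC _ ?_)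
    refine (abs_sub _ _).trans (add_le_add le_rfl ?_)
    refine (Finset.abs_sum_le_sum_abs _ _).trans (Finset.sum_le_sum fun i _ => ?_)
    rw [abs_mul, abs_of_nonneg (hy i).1]
    exact mul_le_of_le_one_right (abs_nonneg _) (hy i).2

theorem integral_cubeMeasure_succ {n : ℕ} {F : (Fin (n + 1) → ℝ) → ℝ}
    (hF : Integrable F (cubeMeasure (n + 1))) :
    ∫ y, F y ∂cubeMeasure (n + 1) =
      ∫ y, (∫ x in (0 : ℝ)..1, F (Fin.cons x y)) ∂cubeMeasure n := by
  have h := (measurePreserving_piFinSuccAbove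
    (fun _ : Fin (n + 1) => volume.restrict (Set.Icc (0 : ℝ) 1)) 0).symm
  have hF' : Integrable F (Measure.pi fun _ : Fin (n + 1) =>
    volume.restrict (Set.Icc (0 : ℝ) 1)) := hF
  have hG := (h.integrable_comp_emb (MeasurableEquiv.measurableEmbedding _)).2 hF'
  rw [cubeMeasure, ← h.integral_comp']
  refine (integral_prod_symm _ hG).trans ?_
  refine integral_congr_ae (ae_of_all _ fun y => ?_)
  simp only [intervalIntegral.integral_of_le zero_le_one, ← integral_Icc_eq_integral_Ioc]
  refine integral_congr_ae (ae_of_all _ fun x => ?_)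
  simp [MeasurableEquiv.piFinSuccAbove, Fin.insertNthEquiv]

/-- The integral over a cube of a ridge function, in terms of iterated antiderivatives. -/
theorem integral_cubeMeasure_ridge {h : ℕ → ℝ → ℝ} (hm : ∀ k, Measurable (h k))
    (hb : ∀ k (M : ℝ), ∃ C, ∀ x, |x| ≤ M → |h k x| ≤ C)
    (hi : ∀ k u v, ∫ x in u..v, h k x = h (k + 1) v - h (k + 1) u) (n : ℕ) :
    ∀ (k : ℕ) (a : Fin n → ℝ) (b : ℝ), (∀ i, 0 < a i) →
      ∫ y, h k (b - ∑ i, a i * y i) ∂cubeMeasure n =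
        (∏ i, a i)⁻¹ * iteratedDiff n a (h (k + n)) b := by
  induction n with
  | zero =>
    intro k a b _
    simp [cubeMeasure, iteratedDiff, measureReal_def]
  | succ n ih =>
    intro k a b ha
    -- The substitution `x ↦ s - a 0 * x` produces one difference and one factor `(a 0)⁻¹`.
    have key (y : Fin n → ℝ) : ∫ x in (0 : ℝ)..1,
        h k (b - ∑ i, a i * (Fin.cons x y : Fin (n + 1) → ℝ) i) =
        (a 0)⁻¹ * (h (k + 1) (b - ∑ i, Fin.tail a i * y i) -
          h (k + 1) (b - a 0 - ∑ i, Fin.tail a i * y i)) := by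
      have : ∀ x, b - ∑ i, a i * (Fin.cons x y : Fin (n + 1) → ℝ) i =
          (b - ∑ i, Fin.tail a i * y i) - a 0 * x := by
        intro x; simp [Fin.sum_univ_succ, Fin.tail]; ring
      simp only [this]
      rw [intervalIntegral.integral_comp_sub_mul _ (ha 0).ne', hi]
      simp only [smul_eq_mul, mul_one, mul_zero, sub_zero]
      congr 3
      ring
    rw [integral_cubeMeasure_succ (integrable_comp_sub_sum (hm k) (hb k) a b)]
    simp only [key]
    rw [integral_const_mul, integral_sub (integrable_comp_sub_sum (hm _) (hb _) _ _)
      (integrable_comp_sub_sum (hm _) (hb _) _ _), ih _ (Fin.tail a) _ fun i => ha i.succ,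
      ih _ (Fin.tail a) _ fun i => ha i.succ, Fin.prod_univ_succ, mul_inv, ← mul_sub, ← mul_assoc,
      add_assoc, add_comm 1 n]
    rfl

/-! ### Truncated powers and antiderivatives of an indicator -/

/-- The `if` matters at `k = 0`: for `x < 0` the derivative is 0, but `max x 0 ^ 0 = 1`. -/
theorem hasDerivAt_max_pow_succ_of_ne (k : ℕ) {x : ℝ} (hx : x ≠ 0) :
    HasDerivAt (fun x : ℝ => max x 0 ^ (k + 1)) ((k + 1) * if 0 < x then x ^ k else 0) x := by
  rcases hx.lt_or_gt with hx | hx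
  · refine (hasDerivAt_const x (0 : ℝ)).congr_of_eventuallyEq ?_ |>.congr_deriv
      (by simp [hx.le.not_gt])
    filter_upwards [Iio_mem_nhds hx] with y hy
    simp [max_eq_right (le_of_lt (Set.mem_Iio.1 hy))]
  · refine (hasDerivAt_pow (k + 1) x).congr_of_eventuallyEq ?_ |>.congr_deriv (by simp [hx])
    filter_upwards [Ioi_mem_nhds hx] with y hy
    simp [max_eq_left (le_of_lt (Set.mem_Ioi.1 hy))]

theorem contDiff_one_max_pow (k : ℕ) : ContDiff ℝ 1 fun x : ℝ => max x 0 ^ (k + 2) := by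
  have hne (x : ℝ) (hx : x ≠ 0) : HasDerivAt (fun x : ℝ => max x 0 ^ (k + 2))
      ((k + 2) * max x 0 ^ (k + 1)) x := by
    convert! hasDerivAt_max_pow_succ_of_ne (k + 1) hx using 1
    split_ifs with h
    · rw [max_eq_left h.le]; push_cast; ring
    · rw [max_eq_right (not_lt.1 h)]; simp
  have hd (x : ℝ) : HasDerivAt (fun x : ℝ => max x 0 ^ (k + 2))
      ((k + 2) * max x 0 ^ (k + 1)) x := by
    by_cases hx : x = 0
    · subst hx
      -- At the kink, the derivative is the limit of the derivatives nearby.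
      exact hasDerivAt_of_hasDerivAt_of_ne hne (by fun_prop) (by fun_prop)
    · exact hne x hx
  rw [contDiff_one_iff_deriv]
  refine ⟨fun x => (hd x).differentiableAt, ?_⟩
  rw [funext fun x => (hd x).deriv]
  fun_prop

/-- The `k`-th antiderivative of the indicator function of `[0,c]`. -/
noncomputable def indicatorAntideriv (c : ℝ) : ℕ → ℝ → ℝ
  | 0 => Set.indicator (Set.Icc 0 c) 1
  | k + 1 => fun x => (max x 0 ^ (k + 1) - max (x - c) 0 ^ (k + 1)) / (k + 1).factorial

theorem continuous_indicatorAntideriv_succ (c : ℝ) (k : ℕ) :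
    Continuous (indicatorAntideriv c (k + 1)) := by
  unfold indicatorAntideriv; fun_prop

theorem measurable_indicatorAntideriv (c : ℝ) : ∀ k, Measurable (indicatorAntideriv c k)
  | 0 => measurable_const.indicator measurableSet_Icc
  | k + 1 => (continuous_indicatorAntideriv_succ c k).measurable

theorem indicatorAntideriv_bounded (c : ℝ) : ∀ k (M : ℝ), ∃ C, ∀ x, |x| ≤ M →
    |indicatorAntideriv c k x| ≤ C
  | 0, _ => ⟨1, fun x _ => by
      simp only [indicatorAntideriv, Set.indicator]
      split_ifs <;> simp⟩
  | k + 1, M => by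
    obtain ⟨C, hC⟩ := (isCompact_Icc (a := -M) (b := M)).exists_bound_of_continuousOn
      (continuous_indicatorAntideriv_succ c k).continuousOn
    exact ⟨C, fun x hx => hC x (abs_le.1 hx)⟩

theorem hasDerivAt_indicatorAntideriv_succ {c : ℝ} (hc : 0 ≤ c) (k : ℕ) {x : ℝ} (h0 : x ≠ 0)
    (h1 : x ≠ c) :
    HasDerivAt (indicatorAntideriv c (k + 1)) (indicatorAntideriv c k x) x := by
  have h2 := (hasDerivAt_max_pow_succ_of_ne k (sub_ne_zero.2 h1)).comp_sub_const x c
  refine (((hasDerivAt_max_pow_succ_of_ne k h0).sub h2).div_const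
    ((k + 1).factorial : ℝ)).congr_deriv ?_
  cases k with
  | zero =>
    simp only [indicatorAntideriv, Set.indicator, Set.mem_Icc, sub_pos, pow_zero, Pi.one_apply]
    rcases h0.lt_or_gt with h0 | h0 <;> rcases h1.lt_or_gt with h1 | h1
    · simp [h0.not_gt, h1.not_gt, h0.not_ge]
    · linarith
    · simp [h0, h1.not_gt, h0.le, h1.le]
    · simp [h0, h1, h1.not_ge]
  | succ k =>
    have (y : ℝ) : (if 0 < y then y ^ (k + 1) else 0) = max y 0 ^ (k + 1) := by
      split_ifs with h
      · rw [max_eq_left h.le]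
      · rw [max_eq_right (not_lt.1 h)]; simp
    simp only [this, indicatorAntideriv, Nat.factorial_succ (k + 1)]
    push_cast
    field_simp

theorem integral_indicatorAntideriv {c : ℝ} (hc : 0 ≤ c) (k : ℕ) (u v : ℝ) :
    ∫ x in u..v, indicatorAntideriv c k x =
      indicatorAntideriv c (k + 1) v - indicatorAntideriv c (k + 1) u := by
  refine MeasureTheory.integral_eq_of_hasDerivAt_off_countable
    (indicatorAntideriv c (k + 1)) (indicatorAntideriv c k) (s := {0, c}) (Set.to_countable _)
    (continuous_indicatorAntideriv_succ c k).continuousOn (fun x hx => ?_) ?_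
  · have := hx.2
    simp only [Set.mem_insert_iff, Set.mem_singleton_iff, not_or] at this
    exact hasDerivAt_indicatorAntideriv_succ hc k this.1 this.2
  · obtain ⟨C, hC⟩ := indicatorAntideriv_bounded c k (max |u| |v|)
    refine (intervalIntegrable_const (c := C)).mono_fun
      (measurable_indicatorAntideriv c k).aestronglyMeasurable ?_
    refine (ae_restrict_iff' measurableSet_uIoc).2 (ae_of_all _ fun x hx => ?_)
    refine (hC x ?_).trans (le_abs_self C)
    rcases Set.mem_uIoc.1 hx with h | h
    · exact abs_le_max_abs_abs h.1.le h.2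
    · rw [max_comm]; exact abs_le_max_abs_abs h.1.le h.2

/-- The volume of the slab section `{y ∈ [0,1]^n : 0 ≤ b - a·y ≤ c}` of the cube. -/
theorem volume_real_cube_inter_slab {n : ℕ} {a : Fin n → ℝ} (ha : ∀ i, 0 < a i) {c : ℝ}
    (hc : 0 ≤ c) (b : ℝ) :
    volume.real {y : Fin n → ℝ | (∀ i, y i ∈ Set.Icc (0 : ℝ) 1) ∧
      b - ∑ i, a i * y i ∈ Set.Icc 0 c} =
      (∏ i, a i)⁻¹ * iteratedDiff n a (indicatorAntideriv c n) b := by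
  have h := integral_cubeMeasure_ridge (measurable_indicatorAntideriv c)
    (indicatorAntideriv_bounded c) (integral_indicatorAntideriv hc) n 0 a b ha
  rw [zero_add] at h
  rw [← h]
  have hm : MeasurableSet {y : Fin n → ℝ | b - ∑ i, a i * y i ∈ Set.Icc 0 c} :=
    measurableSet_Icc.preimage (by fun_prop)
  have : (fun y : Fin n → ℝ => indicatorAntideriv c 0 (b - ∑ i, a i * y i)) =
      Set.indicator {y | b - ∑ i, a i * y i ∈ Set.Icc 0 c} 1 := by
    ext y; simp [indicatorAntideriv, Set.indicator]
  rw [this, integral_indicator_one hm, cubeMeasure_eq_restrict, measureReal_restrict_apply hm,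
    Set.inter_comm]
  rfl

/-! ### The section as a graph -/

/-- The linear map `y ↦ (-v·y, y)`, whose range is the graph of a linear form. -/
noncomputable def graphMap {n : ℕ} (v : Fin n → ℝ) :
    EuclideanSpace ℝ (Fin n) →ₗ[ℝ] EuclideanSpace ℝ (Fin (n + 1)) where
  toFun y := WithLp.toLp 2 (Fin.cons (-∑ i, v i * y i) fun i => y i)
  map_add' x y := by
    ext i
    refine Fin.cases ?_ (fun i => ?_) i
    · simp [mul_add, Finset.sum_add_distrib, add_comm]
    · simp
  map_smul' c y := by
    ext i
    refine Fin.cases ?_ (fun i => ?_) i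
    · simp [mul_left_comm, Finset.mul_sum]
    · simp

@[simp]
theorem graphMap_apply_zero {n : ℕ} (v : Fin n → ℝ) (y : EuclideanSpace ℝ (Fin n)) :
    graphMap v y 0 = -∑ i, v i * y i := rfl

@[simp]
theorem graphMap_apply_succ {n : ℕ} (v : Fin n → ℝ) (y : EuclideanSpace ℝ (Fin n)) (i : Fin n) :
    graphMap v y i.succ = y i := rfl

/-- The Gram matrix is the rank-one perturbation `1 + v vᵀ` of the identity, with determinant `1 +
|v|²`. -/
theorem normDet_graphMap {n : ℕ} (v : Fin n → ℝ) :
    (graphMap v).normDet = √(1 + ∑ i, v i ^ 2) := by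
  have h := (graphMap v).normDet_sq_eq_det_gram (EuclideanSpace.basisFun (Fin n) ℝ)
  have hg : Matrix.gram ℝ (fun i => graphMap v (EuclideanSpace.basisFun (Fin n) ℝ i)) =
      1 + Matrix.replicateCol Unit v * Matrix.replicateRow Unit v := by
    ext i j
    rw [Matrix.gram_apply, PiLp.inner_apply, Fin.sum_univ_succ]
    simp [Matrix.one_apply, Matrix.mul_apply, Finset.sum_ite_eq, mul_comm, add_comm, eq_comm]
  rw [hg, Matrix.det_one_add_replicateCol_mul_replicateRow] at h
  rw [← Real.sqrt_sq (graphMap v).normDet_nonneg]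
  congr 1
  simpa [dotProduct, sq] using h

/-- The slab condition is `0 ≤ x 0 ≤ 1` multiplied by `a 0 > 0`. -/
theorem section_eq_vadd_image {n : ℕ} (t : ℝ) {a : EuclideanSpace ℝ (Fin (n + 1))}
    (ha : a ∈ openOrthant (n + 1)) :
    sectionHyperplane t a ∩ unitCube (n + 1) =
      (fun x => EuclideanSpace.single 0 (offset t a / a 0) + x) ''
        (graphMap (fun i => a i.succ / a 0) '' {y : EuclideanSpace ℝ (Fin n) |
          (∀ i, y i ∈ Set.Icc (0 : ℝ) 1) ∧
            offset t a - ∑ i, a i.succ * y i ∈ Set.Icc 0 (a 0)}) := by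
  have h0 : 0 < a 0 := ha 0
  have hx0 (y : EuclideanSpace ℝ (Fin n)) :
      (EuclideanSpace.single 0 (offset t a / a 0) +
        graphMap (fun i => a i.succ / a 0) y : EuclideanSpace ℝ (Fin (n + 1))) 0 =
      (offset t a - ∑ i, a i.succ * y i) / a 0 := by
    simp only [PiLp.add_apply, PiLp.single_apply, if_true, graphMap_apply_zero,
      div_mul_eq_mul_div]
    rw [sub_div, Finset.sum_div, sub_eq_add_neg]
  have hxs (y : EuclideanSpace ℝ (Fin n)) (i : Fin n) :
      (EuclideanSpace.single 0 (offset t a / a 0) +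
        graphMap (fun i => a i.succ / a 0) y : EuclideanSpace ℝ (Fin (n + 1))) i.succ = y i := by
    simp
  have hinner (x : EuclideanSpace ℝ (Fin (n + 1))) :
      inner ℝ a x = a 0 * x 0 + ∑ i : Fin n, a i.succ * x i.succ := by
    rw [PiLp.inner_apply, Fin.sum_univ_succ]
    simp [mul_comm]
  rw [Set.image_image]
  ext x
  constructor
  · rintro ⟨hx, hc⟩
    have hx' : a 0 * x 0 + ∑ i : Fin n, a i.succ * x i.succ = offset t a := by
      rw [← hinner]; exact hx
    refine ⟨WithLp.toLp 2 fun i => x i.succ, ⟨fun i => hc i.succ, ?_⟩, ?_⟩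
    · have h1 : offset t a - ∑ i : Fin n, a i.succ * x i.succ = a 0 * x 0 := by linarith
      change offset t a - ∑ i : Fin n, a i.succ * x i.succ ∈ _
      rw [h1]
      exact ⟨mul_nonneg h0.le (hc 0).1, mul_le_of_le_one_right h0.le (hc 0).2⟩
    · ext i
      refine Fin.cases ?_ (fun i => ?_) i
      · rw [hx0, div_eq_iff h0.ne', ← hx']
        change a 0 * x 0 + _ - ∑ i : Fin n, a i.succ * x i.succ = _
        ring
      · rw [hxs]
  · rintro ⟨y, ⟨hy, hy0⟩, rfl⟩
    refine ⟨?_, fun i => ?_⟩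
    · change inner ℝ a _ = offset t a
      rw [hinner, hx0, mul_div_cancel₀ _ h0.ne']
      simp only [hxs]
      ring
    · refine Fin.cases ?_ (fun i => ?_) i
      · rw [hx0]
        exact ⟨div_nonneg hy0.1 h0.le, (div_le_one h0).2 hy0.2⟩
      · rw [hxs]
        exact hy i

theorem sectionVolume_eq {n : ℕ} (t : ℝ) {a : EuclideanSpace ℝ (Fin (n + 1))}
    (ha : a ∈ openOrthant (n + 1)) :
    sectionVolume t a = ENNReal.ofReal √(1 + ∑ i : Fin n, (a i.succ / a 0) ^ 2) *
      volume {y : Fin n → ℝ | (∀ i, y i ∈ Set.Icc (0 : ℝ) 1) ∧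
        offset t a - ∑ i, a i.succ * y i ∈ Set.Icc 0 (a 0)} := by
  have h := LinearMap.euclideanHausdorffMeasure_image_eq_normDet_mul_volume
    (graphMap fun i => a i.succ / a 0) {y : EuclideanSpace ℝ (Fin n) |
      (∀ i, y i ∈ Set.Icc (0 : ℝ) 1) ∧ offset t a - ∑ i, a i.succ * y i ∈ Set.Icc 0 (a 0)}
  rw [finrank_euclideanSpace_fin, normDet_graphMap] at h
  rw [sectionVolume, section_eq_vadd_image t ha,
    (isometry_add_left _).euclideanHausdorffMeasure_image, Nat.add_sub_cancel, h]
  congr 1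
  exact (PiLp.volume_preserving_ofLp (Fin n)).measure_preimage_equiv
    (f := (MeasurableEquiv.toLp 2 (Fin n → ℝ)).symm)
    {y : Fin n → ℝ | (∀ i, y i ∈ Set.Icc (0 : ℝ) 1) ∧
      offset t a - ∑ i, a i.succ * y i ∈ Set.Icc 0 (a 0)}

theorem sectionVolume_ne_top {n : ℕ} (t : ℝ) {a : EuclideanSpace ℝ (Fin (n + 1))}
    (ha : a ∈ openOrthant (n + 1)) : sectionVolume t a ≠ ⊤ := by
  rw [sectionVolume_eq t ha]
  refine ENNReal.mul_ne_top ENNReal.ofReal_ne_top ?_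
  refine ((measure_mono (t := Set.Icc (0 : Fin n → ℝ) 1) ?_).trans_lt
    isCompact_Icc.measure_lt_top).ne
  exact fun y hy => ⟨fun i => (hy.1 i).1, fun i => (hy.1 i).2⟩

theorem toReal_sectionVolume {n : ℕ} (t : ℝ) {a : EuclideanSpace ℝ (Fin (n + 1))}
    (ha : a ∈ openOrthant (n + 1)) :
    (sectionVolume t a).toReal = √(1 + ∑ i : Fin n, (a i.succ / a 0) ^ 2) *
      ((∏ i : Fin n, a i.succ)⁻¹ *
        iteratedDiff n (fun i => a i.succ) (indicatorAntideriv (a 0) n) (offset t a)) := by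
  rw [sectionVolume_eq t ha, ENNReal.toReal_mul, ENNReal.toReal_ofReal (Real.sqrt_nonneg _),
    ← volume_real_cube_inter_slab (fun i => ha i.succ) (ha 0).le, measureReal_def]

theorem contDiff_indicatorAntideriv (k : ℕ) :
    ContDiff ℝ 1 fun p : ℝ × ℝ => indicatorAntideriv p.1 (k + 2) p.2 :=
  (((contDiff_one_max_pow k).comp contDiff_snd).sub
    ((contDiff_one_max_pow k).comp (contDiff_snd.sub contDiff_fst))).div_const _

theorem contDiffOn_toReal_sectionVolume (n : ℕ) (t : ℝ) :
    ContDiffOn ℝ 1 (fun a : EuclideanSpace ℝ (Fin (n + 2 + 1)) => (sectionVolume t a).toReal)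
      (openOrthant (n + 2 + 1)) := by
  refine ContDiffOn.congr ?_ fun a ha => toReal_sectionVolume t ha
  have hcoord (i : Fin (n + 2 + 1)) :
      ContDiff ℝ 1 fun a : EuclideanSpace ℝ (Fin (n + 2 + 1)) => a i := by fun_prop
  have hoffset : ContDiff ℝ 1 fun a : EuclideanSpace ℝ (Fin (n + 2 + 1)) => offset t a := by
    unfold offset; fun_prop
  refine ContDiffOn.mul ?_ (ContDiffOn.mul ?_ ?_)
  · refine ContDiffOn.sqrt (contDiffOn_const.add (ContDiffOn.sum fun i _ =>
      ((hcoord _).contDiffOn.div (hcoord 0).contDiffOn fun a ha => (ha 0).ne').pow 2))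
      fun a _ => ?_
    positivity
  · exact (contDiffOn_prod fun i _ => (hcoord i.succ).contDiffOn).inv
      fun a ha => Finset.prod_ne_zero_iff.2 fun i _ => (ha i.succ).ne'
  · refine (ContDiff.iteratedDiff
      (H := fun a : EuclideanSpace ℝ (Fin (n + 2 + 1)) => indicatorAntideriv (a 0) (n + 2)) ?_
      (n + 2) (fun i => hcoord i.succ) hoffset).contDiffOn
    exact (contDiff_indicatorAntideriv n).comp
      (((hcoord 0).comp contDiff_fst).prodMk contDiff_snd)

theorem mainTheorem4 (d : ℕ) (hd : 3 ≤ d) (t : ℝ) :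
    (∀ a ∈ openOrthant d, sectionVolume t a ≠ ⊤) ∧
      ContDiffOn ℝ 1 (fun a : EuclideanSpace ℝ (Fin d) => (sectionVolume t a).toReal)
        (openOrthant d) := by
  -- With d = n + 3 the antiderivative has order n + 2 ≥ 2, as C¹ regularity requires.
  obtain ⟨n, rfl⟩ := Nat.exists_eq_add_of_le' hd
  exact ⟨fun a ha => sectionVolume_ne_top t ha, contDiffOn_toReal_sectionVolume n t⟩
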